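/- Let $\mathbb{H}=\{z\in\mathbb{C}:\operatorname{Im} z>0\}$ and let $j:\mathbb{H}\to\mathbb{C}$ be the modular $j$ function, $j=E_4^3/\Delta$, i.e. the unique holomorphic $\mathrm{SL}_2(\mathbb{Z})$-invariant function with a Fourier expansion of the form $j(z)=q^{-1}+744+\sum_{k\ge 1}a_kq^k$, where $q=e^{2\pi i z}$. Put $j_1=j$, $\mathbb{H}_1=\mathbb{H}$ and, for $n\geq 1$, $\mathbb{H}_{n+1}=\{z\in\mathbb{H}_n: j_n(z)\in\mathbb{H}\}$ and $j_{n+1}=j\circ j_n:\mathbb{H}_{n+1}\to\mathbb{C}$; thus $\mathbb{H}_n$ is the maximal domain of definition of the $n$-fold iterate $j_n$. **Theorem 1.3.** Let $n\geq 1$ be an integer and let $V\subset\mathbb{C}^{n+1}$ be the algebraic hypersurface defined by an irreducible polynomial $p(X,Y_1,\ldots,Y_n)\in\mathbb{C}[X,Y_1,\ldots,Y_n]$ with $\frac{\partial p}{\partial Y_n}\neq 0$ (as a polynomial). Then there are infinitely many points $z\in\mathbb{H}_n$ such that $(z,j(z),j_2(z),\ldots,j_n(z))\in V$, i.e. $p(z,j(z),j_2(z),\ldots,j_n(z))=0$.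 -/

import Mathlib

open scoped UpperHalfPlane

noncomputable section

/-- The modular `j` function `j = E₄³ / Δ` on the upper half-plane, with `E₄ = 1 + 240 q + ⋯` and
`Δ = q ∏ (1 - qⁿ)²⁴ = (E₄³ - E₆²) / 1728`, so that `j = q⁻¹ + 744 + 196884 q + ⋯`. -/
def kleinJ (τ : ℍ) : ℂ :=
  ModularForm.E₄ τ ^ 3 / ModularForm.discriminant τ

/-- `j` as a function on `ℂ`, with the junk value `0` off the upper half-plane. The junk value is
never used on the domains `jDomain` below. -/
def jExt (z : ℂ) : ℂ :=
  if h : 0 < z.im then kleinJ ⟨z, h⟩ else 0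

/-- The `n`-fold composition `jₙ` of `j` with itself: `j₀ = id`, `jₙ₊₁ = j ∘ jₙ`
(so `j₁ = j`). It is meaningful on `jDomain n`. -/
def jIter : ℕ → ℂ → ℂ
  | 0 => fun z => z
  | n + 1 => fun z => jExt (jIter n z)

/-- The maximal domain of definition `ℍₙ` of `jₙ`: `ℍ₀ = ℂ` and
`ℍₙ₊₁ = {z ∈ ℍₙ | jₙ(z) ∈ ℍ}` (so `ℍ₁ = ℍ`). -/
def jDomain : ℕ → Set ℂ
  | 0 => Set.univ
  | n + 1 => {z | z ∈ jDomain n ∧ 0 < (jIter n z).im}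

end

/-!
The zeros are found near the integers on the real axis, by induction on `n`.

Write `F_p(z) = p(z, j(z), …, jₙ(z))`. For integers `k` and `m` the map `z ↦ k - 1 / (z + m)` is the
action of an element of `SL(2, ℤ)`, so it changes none of `j, j₂, …, jₙ`; as `m → ∞` it converges to
the constant `k`, uniformly on compact sets. Hence the functions `z ↦ F_p(k - 1 / (z + m))` converge
locally uniformly to `z ↦ p(k, j(z), …, jₙ(z))`, which is `F_q ∘ j` for the polynomial `q` in one
variable fewer obtained from `p` by setting `X = k`. For a suitable `k` the polynomial `q` still
depends on its last variable, so by induction `F_q` has a zero; as `j` takes every value in `ℂ`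
(`exists_kleinJ_eq`), that zero is some `j(z₀)`, and Hurwitz's theorem gives zeros of
`F_p(k - 1 / (z + m))` near `z₀`, that is, zeros of `F_p` that tend to `k`. As `k` is real, it is not
itself in the domain, so there are infinitely many of them.

Hurwitz's theorem needs the limit not to vanish identically near `z₀`. Since Hurwitz's theorem also
returns an isolated zero, it suffices to carry "the zero is isolated" through the induction
(`exists_isolated_zero_near_intCast`, `exists_isolated_zero_jEval`); no transcendence property of `j`
and its iterates is used. The induction starts from the fundamental theorem of algebra.

Surjectivity of `j` comes from the fact that modular forms of weight zero are constant: if `c` were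
not a value of `j`, then `Δ / (E₄³ - c Δ)` would be a modular form of weight zero without zeros that
vanishes at `i∞`.
-/

open UpperHalfPlane ModularForm SlashInvariantForm MatrixGroups CongruenceSubgroup Filter
open EisensteinSeries MvPolynomial
open scoped Topology

/-! ### The modular function `j` -/

lemma kleinJ_smul (γ : SL(2, ℤ)) (τ : ℍ) : kleinJ (γ • τ) = kleinJ τ := by
  have hd : (denom γ τ : ℂ) ≠ 0 := denom_ne_zero _ _
  have h4 : E₄ (γ • τ) = denom γ τ ^ 4 * E₄ τ := by
    have h : SlashInvariantFormClass (ModularForm 𝒮ℒ 4) Γ(1) 4 :=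
      Gamma_one_coe_eq_SL ▸ inferInstance
    exact_mod_cast slash_action_eqn_SL'' E₄ (mem_Gamma_one γ) τ
  have hD : discriminant (γ • τ) = denom γ τ ^ 12 * discriminant τ := by
    have h : SlashInvariantFormClass (CuspForm 𝒮ℒ 12) Γ(1) 12 :=
      Gamma_one_coe_eq_SL ▸ inferInstance
    exact_mod_cast slash_action_eqn_SL'' CuspForm.discriminant
      (mem_Gamma_one γ) τ
  have := discriminant_ne_zero τ
  rw [kleinJ, kleinJ, h4, hD]
  field_simp

lemma tendsto_E₄_atImInfty : Tendsto E₄ atImInfty (𝓝 1) := by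
  have hc := (ModularFormClass.analyticAt_cuspFunction_zero E₄ one_pos
    one_mem_strictPeriods_SL).continuousAt
  have h1 : cuspFunction 1 E₄ 0 = 1 := by
    simpa [qExpansion_coeff] using E_qExpansion_coeff_zero (k := 4) (by norm_num) ⟨2, rfl⟩
  have ht := hc.tendsto.comp (UpperHalfPlane.qParam_tendsto_atImInfty one_pos)
  rw [h1] at ht
  refine ht.congr fun τ => ?_
  exact SlashInvariantFormClass.eq_cuspFunction E₄ τ one_mem_strictPeriods_SL one_ne_zero

/-- The function `j` takes every complex value. -/
lemma exists_kleinJ_eq (c : ℂ) : ∃ τ, kleinJ τ = c := by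
  by_contra! hne
  let f : ModularForm 𝒮ℒ 12 :=
    mcast (by norm_num) (E₄.pow 3) - c • (CuspForm.discriminant : ModularForm 𝒮ℒ 12)
  have hf : ∀ τ, f τ = E₄ τ ^ 3 - c * discriminant τ := fun τ => by
    simp [f, Pi.pow_apply, congrFun (coe_pow E₄ 3) τ]
  have hf0 : ∀ τ, f τ ≠ 0 := fun τ h => hne τ <| by
    rw [kleinJ, div_eq_iff (discriminant_ne_zero τ)]
    exact sub_eq_zero.mp (by rw [← hf, h])
  have hlim : Tendsto f atImInfty (𝓝 1) := by
    have h := (tendsto_E₄_atImInfty.pow 3).sub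
      ((show Tendsto discriminant atImInfty (𝓝 0) from discriminant_isZeroAtImInfty).const_mul c)
    simpa [← hf] using h
  have hq : Tendsto (fun τ => discriminant τ / f τ) atImInfty (𝓝 0) := by
    have h := (show Tendsto discriminant atImInfty (𝓝 0) from
      discriminant_isZeroAtImInfty).div hlim one_ne_zero
    rw [zero_div] at h
    exact h
  have hslash : ∀ γ : SL(2, ℤ), (fun τ => discriminant τ / f τ) ∣[(0 : ℤ)] γ =
      fun τ => discriminant τ / f τ := fun γ => by
    have hγ : (γ : GL (Fin 2) ℝ) ∈ 𝒮ℒ := ⟨γ, rfl⟩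
    -- the weight is written as a difference to match the slash action on a quotient
    change (⇑CuspForm.discriminant / ⇑f) ∣[(12 - 12 : ℤ)] γ = ⇑CuspForm.discriminant / ⇑f
    simp_rw [div_slash_SL2, SL_slash, slash_action_eqn _ _ hγ]
  let g : ModularForm 𝒮ℒ 0 :=
    { toFun τ := discriminant τ / f τ
      slash_action_eq' := fun _ ⟨γ, hγ⟩ => hγ ▸ hslash γ
      holo' := CuspForm.discriminant.holo'.div f.holo' hf0
      bdd_at_cusps' {x} hx := by
        rw [Subgroup.IsArithmetic.isCusp_iff_isCusp_SL2Z] at hx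
        rw [OnePoint.isBoundedAt_iff_forall_SL2Z hx]
        intro γ _
        rw [hslash γ, IsBoundedAtImInfty, BoundedAtFilter]
        exact hq.isBigO_one ℝ }
  obtain ⟨a, ha⟩ := ModularFormClass.levelOne_weight_zero_const g
  have hga : ∀ τ, discriminant τ / f τ = a := fun τ => congrFun ha τ
  have ha0 : a = 0 := by
    simp_rw [hga] at hq
    exact tendsto_nhds_unique tendsto_const_nhds hq
  exact div_ne_zero (discriminant_ne_zero I) (hf0 I) ((hga I).trans ha0)

lemma jExt_coe (τ : ℍ) : jExt τ = kleinJ τ := by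
  simp [jExt, τ.im_pos]

lemma analyticOnNhd_jExt : AnalyticOnNhd ℂ jExt {z | 0 < z.im} := by
  refine DifferentiableOn.analyticOnNhd ?_ isOpen_upperHalfPlaneSet
  have h4 := UpperHalfPlane.mdifferentiable_iff.mp E₄.holo'
  have hD := UpperHalfPlane.mdifferentiable_iff.mp CuspForm.discriminant.holo'
  refine (DifferentiableOn.div (h4.pow 3) hD fun z _ => discriminant_ne_zero _).congr ?_
  intro z hz
  have hz' : 0 < z.im := hz
  simp [jExt, hz', kleinJ, ofComplex_apply_of_im_pos hz']

lemma im_intCast_sub_inv_pos (k m : ℤ) {z : ℂ} (hz : 0 < z.im) :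
    0 < ((k : ℂ) - (z + m)⁻¹).im := by
  have h : 0 < (z + m).im := by simpa using hz
  have h0 : 0 < Complex.normSq (z + m) := Complex.normSq_pos.mpr fun h' => by simp [h'] at h
  simp only [Complex.sub_im, Complex.intCast_im, Complex.inv_im, zero_sub]
  rw [neg_div, neg_neg]
  positivity

/-- Invariance of `j` under `T ^ k * S * T ^ m`, which acts by `z ↦ k - 1 / (z + m)`. -/
lemma jExt_intCast_sub_inv (k m : ℤ) {z : ℂ} (hz : 0 < z.im) :
    jExt ((k : ℂ) - (z + m)⁻¹) = jExt z := by
  let τ : ℍ := ⟨z, hz⟩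
  have h : ((((ModularGroup.T ^ k * ModularGroup.S * ModularGroup.T ^ m : SL(2, ℤ)) • τ : ℍ)) : ℂ) =
      (k : ℂ) - (z + m)⁻¹ := by
    rw [mul_smul, mul_smul, ModularGroup.coe_T_zpow_smul_eq, modular_S_smul]
    simp only [ModularGroup.coe_T_zpow_smul_eq, τ]
    rw [inv_neg]
    ring
  rw [← h, jExt_coe, kleinJ_smul, ← jExt_coe]

lemma exists_jExt_eq (c : ℂ) : ∃ z : ℂ, 0 < z.im ∧ jExt z = c := by
  obtain ⟨τ, hτ⟩ := exists_kleinJ_eq c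
  exact ⟨τ, τ.im_pos, (jExt_coe τ).trans hτ⟩

/-- Near a point of the upper half-plane `j` takes its value there only once: `j` is not locally
constant, because it is surjective. -/
lemma jExt_tendsto_punctured {z : ℂ} (hz : 0 < z.im) :
    Tendsto jExt (𝓝[≠] z) (𝓝[≠] (jExt z)) := by
  refine tendsto_nhdsWithin_iff.mpr
    ⟨(analyticOnNhd_jExt z hz).continuousAt.tendsto.mono_left nhdsWithin_le_nhds, ?_⟩
  rcases (analyticOnNhd_jExt z hz).eventually_eq_or_eventually_ne
    (analyticAt_const (v := jExt z)) with h | h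
  · have hc := analyticOnNhd_jExt.eqOn_of_preconnected_of_eventuallyEq analyticOnNhd_const
      (convex_halfSpace_im_gt 0).isPreconnected hz h
    obtain ⟨w, hw, hw'⟩ := exists_jExt_eq (jExt z + 1)
    exact absurd (hw'.symm.trans (hc hw)) (by simp)
  · exact h

/-! ### The iterates of `j` and their domains -/

lemma jIter_succ (k : ℕ) (z : ℂ) : jIter (k + 1) z = jIter k (jExt z) := by
  induction k with
  | zero => rfl
  | succ k ih => exact congrArg jExt ih

lemma mem_jDomain_succ {k : ℕ} {z : ℂ} :
    z ∈ jDomain (k + 1) ↔ 0 < z.im ∧ jExt z ∈ jDomain k := by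
  induction k with
  | zero => simp [jDomain, jIter]
  | succ k ih =>
    change (z ∈ jDomain (k + 1) ∧ 0 < (jIter (k + 1) z).im) ↔
      0 < z.im ∧ jExt z ∈ jDomain k ∧ 0 < (jIter k (jExt z)).im
    rw [ih, jIter_succ, and_assoc]

lemma jDomain_antitone : Antitone jDomain :=
  antitone_nat_of_succ_le fun _ _ h => h.1

lemma analyticOnNhd_jIter (k : ℕ) : AnalyticOnNhd ℂ (jIter k) (jDomain k) := by
  induction k with
  | zero => exact analyticOnNhd_id
  | succ k ih => exact fun z hz => (analyticOnNhd_jExt _ hz.2).comp (ih z hz.1)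

lemma isOpen_jDomain (k : ℕ) : IsOpen (jDomain k) := by
  induction k with
  | zero => exact isOpen_univ
  | succ k ih =>
    exact (analyticOnNhd_jIter k).continuousOn.isOpen_inter_preimage ih isOpen_upperHalfPlaneSet

/-! ### Specializing the first variable of a polynomial -/

namespace MvPolynomial

/-- The polynomial `p(x, Y₁, …, Yₙ)`, with `Yᵢ` renumbered as the variable `i - 1`. -/
noncomputable def specializeZero {R : Type*} [CommRing R] {n : ℕ} (x : R) :
    MvPolynomial (Fin (n + 1)) R →ₐ[R] MvPolynomial (Fin n) R :=
  aeval (Fin.cons (C x) X)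

lemma eval_specializeZero {R : Type*} [CommRing R] {n : ℕ} (x : R) (y : Fin n → R)
    (p : MvPolynomial (Fin (n + 1)) R) :
    eval y (specializeZero x p) = eval (Fin.cons x y) p := by
  induction p using MvPolynomial.induction_on with
  | C a => simp [specializeZero]
  | add p q hp hq => simp [hp, hq]
  | mul_X p i hp =>
    rw [map_mul, map_mul, map_mul, hp]
    refine Fin.cases ?_ (fun i => ?_) i <;> simp [specializeZero]

lemma pderiv_specializeZero {R : Type*} [CommRing R] {n : ℕ} (x : R) (i : Fin n)
    (p : MvPolynomial (Fin (n + 1)) R) :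
    pderiv i (specializeZero x p) = specializeZero x (pderiv i.succ p) := by
  induction p using MvPolynomial.induction_on with
  | C a => simp [specializeZero]
  | add p q hp hq => simp [hp, hq]
  | mul_X p j hp =>
    rw [map_mul, Derivation.leibniz, Derivation.leibniz, hp]
    refine Fin.cases ?_ (fun j => ?_) j
    · simp [specializeZero, Fin.succ_ne_zero]
    · simp only [specializeZero, aeval_X, Fin.cons_succ, pderiv_X, Pi.single_apply,
        Fin.succ_inj, smul_eq_mul, map_add, map_mul]
      split_ifs <;> simp

lemma specializeZero_eq_eval_finSuccEquiv {R : Type*} [CommRing R] {n : ℕ} (x : R)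
    (p : MvPolynomial (Fin (n + 1)) R) :
    specializeZero x p = (finSuccEquiv R n p).eval (C x) := by
  induction p using MvPolynomial.induction_on with
  | C a => simp [specializeZero, algebraMap_eq, finSuccEquiv_apply]
  | add p q hp hq => simp [hp, hq]
  | mul_X p j hp =>
    rw [map_mul, map_mul, Polynomial.eval_mul, hp]
    refine Fin.cases ?_ (fun j => ?_) j <;> simp [specializeZero, finSuccEquiv_X_zero,
      finSuccEquiv_X_succ]

lemma exists_int_specializeZero_ne_zero {n : ℕ} {q : MvPolynomial (Fin (n + 1)) ℂ} (hq : q ≠ 0) :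
    ∃ k : ℤ, specializeZero (k : ℂ) q ≠ 0 := by
  by_contra! h
  refine hq ((finSuccEquiv ℂ n).map_eq_zero_iff.mp ?_)
  refine Polynomial.eq_zero_of_infinite_isRoot _ ?_
  have hinj : Function.Injective fun k : ℤ => (C (k : ℂ) : MvPolynomial (Fin n) ℂ) :=
    (C_injective _ _).comp Int.cast_injective
  refine (Set.infinite_range_of_injective hinj).mono ?_
  rintro _ ⟨k, rfl⟩
  exact (specializeZero_eq_eval_finSuccEquiv _ _).symm.trans (h k)

/-- The case of one variable, where the zero comes from the fundamental theorem of algebra. -/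
lemma exists_isolated_zero {p : MvPolynomial (Fin 1) ℂ} (hp : pderiv 0 p ≠ 0) :
    ∃ z : ℂ, eval (fun _ => z) p = 0 ∧ ∀ᶠ w in 𝓝[≠] z, eval (fun _ => w) p ≠ 0 := by
  let Q : Polynomial ℂ := aeval (fun _ => Polynomial.X) p
  -- `p` is recovered from `Q`, so it would be constant if `Q` were
  have hinj : Function.LeftInverse (Polynomial.aeval (X 0 : MvPolynomial (Fin 1) ℂ))
      (aeval fun _ : Fin 1 => (Polynomial.X : Polynomial ℂ)) := fun q => by
    induction q using MvPolynomial.induction_on with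
    | C a => simp [algebraMap_eq]
    | add p q hp hq => simp [hp, hq]
    | mul_X p i hp => simp [hp, Subsingleton.elim i 0]
  have heval : ∀ z : ℂ, Q.eval z = eval (fun _ => z) p := fun z => by
    have h : (Polynomial.evalRingHom z).comp (algebraMap ℂ (Polynomial ℂ)) = RingHom.id ℂ := by
      ext; simp
    rw [← Polynomial.coe_evalRingHom]
    simp only [Q, aeval_def, hom_eval₂, h, eval₂_id]
    simp
  have hdeg : 0 < Q.degree := by
    by_contra h
    have hp' := hinj p
    rw [show aeval (fun _ : Fin 1 => (Polynomial.X : Polynomial ℂ)) p = Q from rfl,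
      Polynomial.eq_C_of_degree_le_zero (not_lt.mp h), Polynomial.aeval_C] at hp'
    exact hp (by rw [← hp', algebraMap_eq, pderiv_C])
  obtain ⟨z, hz⟩ := Complex.exists_root hdeg
  refine ⟨z, (heval z).symm.trans hz, ?_⟩
  have hfin : {w | Q.IsRoot w}.Finite :=
    Polynomial.finite_setOfPred_isRoot (Polynomial.ne_zero_of_degree_gt hdeg)
  filter_upwards [nhdsWithin_le_nhds
    ((hfin.sdiff (t := {z})).isClosed.isOpen_compl.mem_nhds (by simp : z ∉ _)),
    self_mem_nhdsWithin] with w hw hwz h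
  exact hw ⟨(heval w).trans h, hwz⟩

end MvPolynomial

/-! ### Hurwitz's theorem -/

/-- A quantitative form of Hurwitz's theorem: a function that is much smaller at the centre of a disc
than on its boundary has a zero in the disc, and the zero is isolated. -/
lemma exists_isolated_zero_of_small_center {G : ℂ → ℂ} {z₀ : ℂ} {r ε : ℝ} (hr : 0 < r) (hε : 0 < ε)
    (hG : AnalyticOnNhd ℂ G (Metric.closedBall z₀ r)) (hc : ‖G z₀‖ < ε)
    (hs : ∀ z ∈ Metric.sphere z₀ r, 3 * ε ≤ ‖G z‖) :
    ∃ z ∈ Metric.closedBall z₀ r, G z = 0 ∧ ∀ᶠ w in 𝓝[≠] z, G w ≠ 0 := by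
  have hpre : IsPreconnected (Metric.closedBall z₀ r) := (convex_closedBall _ _).isPreconnected
  have hne : ∀ z ∈ Metric.closedBall z₀ r, ∀ c : ℂ, ‖c‖ < ε → ∀ᶠ w in 𝓝[≠] z, G w ≠ c := by
    intro z hz c hcε
    rcases (hG z hz).eventually_eq_or_eventually_ne (analyticAt_const (v := c)) with h | h
    · have heq := hG.eqOn_of_preconnected_of_eventuallyEq analyticOnNhd_const hpre hz h
      obtain ⟨w, hw⟩ : (Metric.sphere z₀ r).Nonempty := NormedSpace.sphere_nonempty.mpr hr.le
      have h1 := hs w hw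
      rw [heq (Metric.sphere_subset_closedBall hw)] at h1
      linarith
    · exact h
  have hd : DiffContOnCl ℂ G (Metric.ball z₀ r) :=
    DifferentiableOn.diffContOnCl (by
      rw [closure_ball _ hr.ne']; exact hG.differentiableOn)
  have hsub := hd.ball_subset_image_closedBall hr (ε := 2 * ε)
    (fun z hz => by
      have h1 := hs z hz
      have h2 := norm_sub_norm_le (G z) (G z₀)
      linarith)
    ((hne z₀ (Metric.mem_closedBall_self hr.le) _ hc).frequently.filter_mono nhdsWithin_le_nhds)
  obtain ⟨z, hz, hz0⟩ := hsub (show (0 : ℂ) ∈ Metric.ball (G z₀) (2 * ε / 2) by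
    simpa [dist_eq_norm] using hc)
  exact ⟨z, hz, hz0, hne z hz 0 (by simpa using hε)⟩

/-! ### Polynomials in the iterates of `j` -/

/-- The function `z ↦ p(z, j(z), …, jₙ(z))`. -/
noncomputable def jEval {n : ℕ} (p : MvPolynomial (Fin (n + 1)) ℂ) (z : ℂ) : ℂ :=
  MvPolynomial.eval (fun i : Fin (n + 1) => jIter (i : ℕ) z) p

lemma analyticOnNhd_jIter_of_le {k n : ℕ} (h : k ≤ n) : AnalyticOnNhd ℂ (jIter k) (jDomain n) :=
  (analyticOnNhd_jIter k).mono (jDomain_antitone h)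

lemma analyticOnNhd_jEval {n : ℕ} (p : MvPolynomial (Fin (n + 1)) ℂ) :
    AnalyticOnNhd ℂ (jEval p) (jDomain n) :=
  AnalyticOnNhd.aeval_mvPolynomial (f := fun z (i : Fin (n + 1)) => jIter (i : ℕ) z)
    (fun i => analyticOnNhd_jIter_of_le (Nat.lt_succ_iff.mp i.is_lt)) p

/-- The function `(s, z) ↦ p(s, j(z), …, jₙ(z))`, in which the first variable of `p` is freed from
`z`. -/
noncomputable def jEvalAt {n : ℕ} (p : MvPolynomial (Fin (n + 1)) ℂ) (s z : ℂ) : ℂ :=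
  MvPolynomial.eval (Fin.cons s fun i : Fin n => jIter (i + 1 : ℕ) z) p

lemma jEvalAt_eq_jEval_specializeZero {n : ℕ} (p : MvPolynomial (Fin (n + 2)) ℂ) (x z : ℂ) :
    jEvalAt p x z = jEval (MvPolynomial.specializeZero x p) (jExt z) := by
  simp only [jEvalAt, jEval, MvPolynomial.eval_specializeZero, jIter_succ]

lemma jEval_intCast_sub_inv {n : ℕ} (p : MvPolynomial (Fin (n + 1)) ℂ) (k m : ℤ) {z : ℂ}
    (hz : 0 < z.im) :
    jEval p ((k : ℂ) - (z + m)⁻¹) = jEvalAt p ((k : ℂ) - (z + m)⁻¹) z := by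
  refine congrArg (fun y => MvPolynomial.eval y p) (funext fun i => ?_)
  refine Fin.cases rfl (fun i => ?_) i
  simp [jIter_succ, jExt_intCast_sub_inv k m hz]

lemma intCast_sub_inv_mem_jDomain {n : ℕ} (k m : ℤ) {z : ℂ} (hz : z ∈ jDomain (n + 1)) :
    (k : ℂ) - (z + m)⁻¹ ∈ jDomain (n + 1) := by
  rw [mem_jDomain_succ] at hz ⊢
  exact ⟨im_intCast_sub_inv_pos k m hz.1, by rw [jExt_intCast_sub_inv k m hz.1]; exact hz.2⟩

lemma continuousAt_jEvalAt {n : ℕ} (p : MvPolynomial (Fin (n + 2)) ℂ) (s : ℂ) {z : ℂ}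
    (hz : z ∈ jDomain (n + 1)) :
    ContinuousAt (fun q : ℂ × ℂ => jEvalAt p q.2 q.1) (z, s) := by
  refine (MvPolynomial.continuous_eval p).continuousAt.comp (continuousAt_pi.mpr fun i => ?_)
  refine Fin.cases ?_ (fun i => ?_) i
  · exact continuousAt_snd
  · exact ContinuousAt.comp (f := Prod.fst) (g := jIter (i + 1))
      (analyticOnNhd_jIter_of_le (Nat.succ_le_of_lt i.is_lt) z hz).continuousAt continuousAt_fst

/-- The inductive step: if `p(k, ·)` evaluated on the iterates of `j` has an isolated zero, then `p`
evaluated on them has isolated zeros arbitrarily close to the integer `k`. -/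
lemma exists_isolated_zero_near_intCast {n : ℕ} {p : MvPolynomial (Fin (n + 2)) ℂ} {k : ℤ} {u : ℂ}
    (hu : u ∈ jDomain n) (hu0 : jEval (specializeZero (k : ℂ) p) u = 0)
    (hiso : ∀ᶠ w in 𝓝[≠] u, jEval (specializeZero (k : ℂ) p) w ≠ 0) {ρ : ℝ} (hρ : 0 < ρ) :
    ∃ w ∈ jDomain (n + 1), ‖w - k‖ < ρ ∧ jEval p w = 0 ∧ ∀ᶠ v in 𝓝[≠] w, jEval p v ≠ 0 := by
  obtain ⟨z₀, hz₀, rfl⟩ := exists_jExt_eq u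
  have hz₀D : z₀ ∈ jDomain (n + 1) := mem_jDomain_succ.mpr ⟨hz₀, hu⟩
  have hiso' : ∀ᶠ z in 𝓝[≠] z₀, jEvalAt p k z ≠ 0 := by
    simpa only [jEvalAt_eq_jEval_specializeZero] using (jExt_tendsto_punctured hz₀).eventually hiso
  obtain ⟨R, hR, hball⟩ := Metric.eventually_nhds_iff_ball.mp
    (((isOpen_jDomain (n + 1)).eventually_mem hz₀D).and (eventually_nhdsWithin_iff.mp hiso'))
  obtain ⟨r, hr, hrR⟩ := exists_between hR
  have hK : ∀ z ∈ Metric.closedBall z₀ r, z ∈ Metric.ball z₀ R := fun z hz =>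
    Metric.closedBall_subset_ball hrR hz
  have hcont : ContinuousOn (fun z => ‖jEvalAt p k z‖) (Metric.sphere z₀ r) := fun z hz =>
    ((continuousAt_jEvalAt p k (hball z (hK z (Metric.sphere_subset_closedBall hz))).1).comp
      (f := fun z : ℂ => (z, (k : ℂ))) (by fun_prop)).norm.continuousWithinAt
  obtain ⟨z₁, hz₁, hmin⟩ := (isCompact_sphere z₀ r).exists_isMinOn
    (NormedSpace.sphere_nonempty.mpr hr.le) hcont
  have hδ : 0 < ‖jEvalAt p k z₁‖ := norm_pos_iff.mpr <|
    (hball z₁ (hK z₁ (Metric.sphere_subset_closedBall hz₁))).2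
      (Metric.ne_of_mem_sphere hz₁ hr.ne')
  -- with `4ε` as lower bound on the circle, an `ε`-perturbation is at least `3ε` there
  obtain ⟨ε, hε, hεδ⟩ : ∃ ε > 0, 4 * ε = ‖jEvalAt p k z₁‖ :=
    ⟨‖jEvalAt p k z₁‖ / 4, by positivity, by ring⟩
  have hunif : ∀ᶠ s in 𝓝 (k : ℂ), ∀ z ∈ Metric.closedBall z₀ r,
      ‖jEvalAt p s z - jEvalAt p k z‖ < ε := by
    refine (isCompact_closedBall z₀ r).eventually_forall_of_forall_eventually fun z hz => ?_
    have hzD := (hball z (hK z hz)).1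
    have hd : ContinuousAt
        (fun q : ℂ × ℂ => ‖jEvalAt p q.2 q.1 - jEvalAt p k q.1‖) (z, (k : ℂ)) :=
      ((continuousAt_jEvalAt p k hzD).sub
        ((continuousAt_jEvalAt p k hzD).comp_of_eq
          (f := fun q : ℂ × ℂ => (q.1, (k : ℂ))) (by fun_prop) rfl)).norm
    have := hd.eventually_lt (g := fun _ => ε) continuousAt_const (by simpa using hε)
    exact (continuous_swap.tendsto ((k : ℂ), z)).eventually this
  obtain ⟨t, ht, htball⟩ := Metric.eventually_nhds_iff_ball.mp
    (hunif.and (Metric.ball_mem_nhds (k : ℂ) hρ))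
  -- this `m` makes `‖z + m‖ > 1 / t`, hence `k - 1 / (z + m)` is `t`-close to `k`, on the disc
  obtain ⟨m, hm⟩ := exists_nat_gt (t⁻¹ + (‖z₀‖ + r))
  have hclose : ∀ z ∈ Metric.closedBall z₀ r,
      (k : ℂ) - (z + (m : ℤ))⁻¹ ∈ Metric.ball (k : ℂ) t := by
    intro z hz
    have h1 : ‖z‖ ≤ ‖z₀‖ + r := norm_le_norm_add_const_of_dist_le hz
    have h2 : (m : ℝ) - ‖z‖ ≤ ‖z + (m : ℤ)‖ := by
      have := norm_sub_norm_le (m : ℂ) (-z)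
      rwa [sub_neg_eq_add, norm_neg, Complex.norm_natCast, add_comm] at this
    have h3 : t⁻¹ < ‖z + (m : ℤ)‖ := by linarith
    rw [mem_ball_iff_norm, sub_sub_cancel_left, norm_neg, norm_inv]
    exact inv_lt_of_inv_lt₀ ht h3
  have hbound : ∀ z ∈ Metric.closedBall z₀ r,
      ‖jEval p ((k : ℂ) - (z + (m : ℤ))⁻¹) - jEvalAt p k z‖ < ε := by
    intro z hz
    rw [jEval_intCast_sub_inv p k m (mem_jDomain_succ.mp (hball z (hK z hz)).1).1]
    exact (htball _ (hclose z hz)).1 z hz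
  have hmob : ∀ z ∈ Metric.closedBall z₀ r,
      AnalyticAt ℂ (fun z : ℂ => (k : ℂ) - (z + (m : ℤ))⁻¹) z := by
    intro z hz
    have him : 0 < z.im := (mem_jDomain_succ.mp (hball z (hK z hz)).1).1
    have hne : z + (m : ℤ) ≠ 0 := fun h => him.ne' (by simpa using congrArg Complex.im h)
    fun_prop (disch := exact hne)
  have hmem : ∀ z ∈ Metric.closedBall z₀ r, (k : ℂ) - (z + (m : ℤ))⁻¹ ∈ jDomain (n + 1) :=
    fun z hz => intCast_sub_inv_mem_jDomain k m (hball z (hK z hz)).1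
  obtain ⟨z, hz, hz0, hziso⟩ := exists_isolated_zero_of_small_center
    (G := fun z => jEval p ((k : ℂ) - (z + (m : ℤ))⁻¹)) hr hε
    (fun z hz => AnalyticAt.fun_comp (g := jEval p)
      (f := fun z : ℂ => (k : ℂ) - (z + (m : ℤ))⁻¹)
      (analyticOnNhd_jEval p _ (hmem z hz)) (hmob z hz))
    (by simpa [jEvalAt_eq_jEval_specializeZero, hu0] using
      hbound z₀ (Metric.mem_closedBall_self hr.le))
    (fun z hz => by
      have h1 := hbound z (Metric.sphere_subset_closedBall hz)
      have h2 : ‖jEvalAt p k z₁‖ ≤ ‖jEvalAt p k z‖ := hmin hz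
      have h3 := norm_sub_norm_le (jEvalAt p k z) (jEval p ((k : ℂ) - (z + (m : ℤ))⁻¹))
      rw [norm_sub_rev] at h3
      linarith)
  refine ⟨_, hmem z hz, mem_ball_iff_norm.mp (htball _ (hclose z hz)).2, hz0, ?_⟩
  -- if `jEval p` vanished near the new zero, so would its composition with the Möbius map near `z`
  refine (analyticOnNhd_jEval p _ (hmem z hz)).eventually_eq_zero_or_eventually_ne_zero.resolve_left
    fun h => ?_
  have := (((hmob z hz).continuousAt.tendsto.eventually h).filter_mono
    (nhdsWithin_le_nhds (s := {z}ᶜ))).and hziso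
  obtain ⟨w, hw, hw'⟩ := this.exists
  exact hw' hw

lemma exists_isolated_zero_jEval (n : ℕ) {p : MvPolynomial (Fin (n + 1)) ℂ}
    (hp : pderiv (Fin.last n) p ≠ 0) :
    ∃ z ∈ jDomain n, jEval p z = 0 ∧ ∀ᶠ w in 𝓝[≠] z, jEval p w ≠ 0 := by
  induction n with
  | zero =>
    obtain ⟨z, hz, hiso⟩ := MvPolynomial.exists_isolated_zero hp
    have h : ∀ w, jEval p w = eval (fun _ => w) p := fun w =>
      congrArg (fun y => eval y p) (funext fun i => Fin.cases rfl (fun i => i.elim0) i)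
    exact ⟨z, trivial, (h z).trans hz, by simpa only [h] using hiso⟩
  | succ n ih =>
    obtain ⟨k, hk⟩ := exists_int_specializeZero_ne_zero hp
    rw [← Fin.succ_last, ← pderiv_specializeZero] at hk
    obtain ⟨u, hu, hu0, hiso⟩ := ih hk
    obtain ⟨w, hw, -, h⟩ := exists_isolated_zero_near_intCast hu hu0 hiso one_pos
    exact ⟨w, hw, h⟩

theorem theorem1p3 (n : ℕ) (hn : 1 ≤ n) (p : MvPolynomial (Fin (n + 1)) ℂ)
    (hp : Irreducible p) (hpY : MvPolynomial.pderiv (Fin.last n) p ≠ 0) :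
    {z : ℂ | z ∈ jDomain n ∧
      MvPolynomial.eval (fun i : Fin (n + 1) => jIter (i : ℕ) z) p = 0}.Infinite := by
  obtain ⟨n, rfl⟩ := Nat.exists_eq_succ_of_ne_zero (Nat.one_le_iff_ne_zero.mp hn)
  obtain ⟨k, hk⟩ := exists_int_specializeZero_ne_zero hpY
  rw [← Fin.succ_last, ← pderiv_specializeZero] at hk
  obtain ⟨u, hu, hu0, hiso⟩ := exists_isolated_zero_jEval n hk
  intro hfin
  have hkD : (k : ℂ) ∉ {z : ℂ | z ∈ jDomain (n + 1) ∧ jEval p z = 0} := fun h => by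
    simpa using (mem_jDomain_succ.mp h.1).1
  obtain ⟨ρ, hρ, hsub⟩ := Metric.isOpen_iff.mp hfin.isClosed.isOpen_compl (k : ℂ) hkD
  obtain ⟨w, hw, hwk, hw0, -⟩ := exists_isolated_zero_near_intCast hu hu0 hiso hρ
  exact hsub (mem_ball_iff_norm.mpr hwk) ⟨hw, hw0⟩
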